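/- Let $c,d\in\mathbb N$, let $H,Q_1,\dots,Q_c$ be $d\times d$ complex Hermitian matrices and let $q\in\mathbb R^c$. Write $\mu\cdot q=\sum_i\mu_iq_i$ and $\mu\cdot Q=\sum_i\mu_iQ_i$ for $\mu\in\mathbb R^c$. Assume that some $M$ with $0\le M\le I$ satisfies $\operatorname{Tr}[Q_iM]=q_i$ for all $i$, and let $$E=\min\{\operatorname{Tr}[HM]:\ 0\le M\le I,\ \operatorname{Tr}[Q_iM]=q_i\ \text{for all } i\}.$$ Let $T>0$ and define $$f(\mu)=\mu\cdot q-\operatorname{Tr}[(H-\mu\cdot Q)_-],\qquad f_T(\mu)=\mu\cdot q-T\operatorname{Tr}\bigl[\ln\bigl(e^{-(H-\mu\cdot Q)/T}+I\bigr)\bigr],$$ where $A_-$ is the (positive semidefinite) negative part of a Hermitian matrix $A$. These are the objectives of the dual problems of $E$ and of the free-energy problem $\min\{\operatorname{Tr}[HM]-T\,(-\operatorname{Tr}[M\ln M]-\operatorname{Tr}[(I-M)\ln(I-M)])\}$ over the same feasible set. Further let $$M_T(\mu)=\bigl(e^{(H-\mu\cdot Q)/T}+I\bigr)^{-1},\qquad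 \tilde f_T(\mu)=\mu\cdot q+\operatorname{Tr}[(H-\mu\cdot Q)M_T(\mu)].$$ Let $\mu^\star$ be a maximizer of $f$ and $\mu_T^\star$ a maximizer of $f_T$ over $\mathbb R^c$, both lying in a set $\mathbb M\subseteq\mathbb R^c$. Suppose that $d_0\in\{0,1,\dots,d\}$ and $\Delta>0$ are such that, for every $\mu\in\mathbb M$, $\dim\ker(H-\mu\cdot Q)\le d_0$ and every nonzero eigenvalue $\lambda$ of $H-\mu\cdot Q$ satisfies $|\lambda|\ge\Delta$. Then, with $s(p)=-p\ln p-(1-p)\ln(1-p)$, $$E+T\Bigl[d_0\ln2+(d-d_0)\,s\Bigl(\frac1{e^{\Delta/T}+1}\Bigr)\Bigr]\ \ge\ \tilde f_T(\mu_T^\star)\ \ge\ E-T\bigl(d_0\ln2+(d-d_0)e^{-\Delta/T}\bigr).$$ Moreover, for all $\varepsilon>0$ and $T_0>0$, if $$T\le\min\left\{T_0,\ \frac{\varepsilon}{2d_0\ln2},\ \frac{\Delta}{\ln\left(\frac{2(d-d_0)(2T_0+\Delta)}{\varepsilon}\right)},\ \frac{\Delta}{\ln\left(\frac{d-d_0}{d_0\ln2}\right)}\right\},$$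 then $|\tilde f_T(\mu_T^\star)-E|\le\varepsilon$. Here an entry $\Delta/\ln(x)$ with $x\le1$ (including $x=0$) is read as $+\infty$, and the second and fourth entries are omitted when $d_0=0$. -/

import Mathlib

noncomputable section

namespace FermiDirac

open Matrix
open scoped ComplexOrder

variable {c d : ℕ}

/-- Measurement operators: Hermitian `d × d` matrices `M` with `0 ≤ M ≤ I`. -/
def measOps (d : ℕ) : Set (Matrix (Fin d) (Fin d) ℂ) :=
  {M | M.PosSemidef ∧ (1 - M).PosSemidef}

/-- Measurement operators meeting all the constraints `Tr[Q i * M] = q i`. -/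
def feasible (Q : Fin c → Matrix (Fin d) (Fin d) ℂ) (q : Fin c → ℝ) :
    Set (Matrix (Fin d) (Fin d) ℂ) :=
  {M | M ∈ measOps d ∧ ∀ i, (Q i * M).trace = (q i : ℂ)}

/-- The optimal value `E` of the measurement optimization problem: the minimum of `Tr[H M]` over
the feasible measurement operators. The feasible set is compact, so that for a non-empty feasible
set this infimum is an attained minimum. -/
def optValue (H : Matrix (Fin d) (Fin d) ℂ) (Q : Fin c → Matrix (Fin d) (Fin d) ℂ)
    (q : Fin c → ℝ) : ℝ :=
  sInf ((fun M => (H * M).trace.re) '' feasible Q q)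

/-- The operator `H - μ · Q`. -/
def shifted (H : Matrix (Fin d) (Fin d) ℂ) (Q : Fin c → Matrix (Fin d) (Fin d) ℂ)
    (μ : Fin c → ℝ) : Matrix (Fin d) (Fin d) ℂ :=
  H - ∑ i, μ i • Q i

/-- The dual objective `f(μ) = μ · q - Tr[(H - μ · Q)₋]` of the measurement optimization problem;
the negative part is that of the continuous functional calculus. -/
def dualObj (H : Matrix (Fin d) (Fin d) ℂ) (Q : Fin c → Matrix (Fin d) (Fin d) ℂ)
    (q : Fin c → ℝ) (μ : Fin c → ℝ) : ℝ :=
  μ ⬝ᵥ q - ((shifted H Q μ)⁻).trace.re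

/-- The temperature-`T` dual objective
`f_T(μ) = μ · q - T Tr[ln(exp(-(H - μ · Q) / T) + I)]`, dual to the minimization of the free
energy `Tr[H M] - T S_FD(M)` over the feasible measurement operators; the matrix logarithm is that
of the continuous functional calculus. -/
def dualFreeObj (H : Matrix (Fin d) (Fin d) ℂ) (Q : Fin c → Matrix (Fin d) (Fin d) ℂ)
    (q : Fin c → ℝ) (T : ℝ) (μ : Fin c → ℝ) : ℝ :=
  μ ⬝ᵥ q -
    T * (cfc Real.log (NormedSpace.exp ((-(1 / T)) • shifted H Q μ) + 1)).trace.re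

/-- The Fermi-Dirac measurement operator `M_T(A) = (exp(A / T) + I)⁻¹`. -/
def fdMeas (T : ℝ) (A : Matrix (Fin d) (Fin d) ℂ) : Matrix (Fin d) (Fin d) ℂ :=
  (NormedSpace.exp ((1 / T) • A) + 1)⁻¹

/-- `f̃_T(μ) = μ · q + Tr[(H - μ · Q) M_T(μ)]` with `M_T(μ) = M_T(H - μ · Q)`. -/
def approxObj (H : Matrix (Fin d) (Fin d) ℂ) (Q : Fin c → Matrix (Fin d) (Fin d) ℂ)
    (q : Fin c → ℝ) (T : ℝ) (μ : Fin c → ℝ) : ℝ :=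
  μ ⬝ᵥ q + (shifted H Q μ * fdMeas T (shifted H Q μ)).trace.re

/-- An upper bound `a / b` on the temperature, which is no constraint (`+∞`) when `b ≤ 0`. -/
def quotBound (a b : ℝ) : EReal :=
  if 0 < b then ((a / b : ℝ) : EReal) else ⊤

/-- The temperature threshold
`min {T₀, ε / (2 d₀ ln 2), Δ / ln (2 (d - d₀) (2 T₀ + Δ) / ε), Δ / ln ((d - d₀) / (d₀ ln 2))}`.
In Lean `x / 0 = 0` and `Real.log 0 = 0`, so an entry with `d₀ = 0` in its denominator or with the
logarithm of `0` is `⊤`, as is one whose logarithm is not positive. -/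
def tempThreshold (d d₀ : ℕ) (Δ T₀ ε : ℝ) : EReal :=
  min (min (T₀ : EReal) (quotBound ε (d₀ * 2 * Real.log 2)))
    (min (quotBound Δ (Real.log (2 * ((d : ℝ) - d₀) * (2 * T₀ + Δ) / ε)))
      (quotBound Δ (Real.log (((d : ℝ) - d₀) / (d₀ * Real.log 2)))))

end FermiDirac

end

/-! Both bounds come from two facts at `μT`. Eigenvalue by eigenvalue, `approxObj` equals
`dualFreeObj` plus `T` times the Fermi-Dirac entropy (`approxObj_eq`), and weak duality
(`dualFreeObj_le`) puts `dualFreeObj` below `E`. The upper error is thus at most the entropy, which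
`sum_binEntropy_le` bounds: `log 2` per kernel direction, and at most the entropy at `Δ` for every
other eigenvalue. From below, a maximizer of `dualFreeObj` is stationary, so its Fermi-Dirac
operator is feasible (`trace_mul_fdMeas_of_isMaxOn`) and `approxObj` is its energy, which is at
least `E`. Stationarity rests on `klein_inequality` and continuity of `fdMeas`; no trace function is
differentiated. -/

namespace FermiDirac

open Matrix
open scoped ComplexOrder

/-! ### Scalar inequalities for the Fermi function and the binary entropy. -/

section Scalar

/-- The tangent inequality of the concave function `x ↦ -log (exp (-x) + 1)`. -/
lemma neg_log_exp_neg_add_one_le (a b : ℝ) :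
    -Real.log (Real.exp (-a) + 1) ≤
      -Real.log (Real.exp (-b) + 1) + (a - b) * (Real.exp b + 1)⁻¹ := by
  set p := (Real.exp b + 1)⁻¹ with hp
  have hb := Real.exp_pos b
  have hp0 : 0 ≤ p := by positivity
  have hp1 : 0 ≤ 1 - p := by
    have : p ≤ 1 := inv_le_one_of_one_le₀ (by linarith)
    linarith
  -- The ratio `(exp (-a) + 1) / (exp (-b) + 1)` is the average of `1` and `exp (b - a)` with
  -- weights `1 - p` and `p`, so convexity of `exp` bounds it below by `exp (p * (b - a))`.
  have hconv := convexOn_exp.2 (Set.mem_univ (0 : ℝ)) (Set.mem_univ (b - a)) hp1 hp0 (by ring)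
  simp only [smul_eq_mul, mul_zero, zero_add, Real.exp_zero, mul_one] at hconv
  have hfac : Real.exp (-a) + 1 = (Real.exp (-b) + 1) * (1 - p + p * Real.exp (b - a)) := by
    rw [hp, Real.exp_sub, Real.exp_neg, Real.exp_neg]
    have := Real.exp_pos a
    field_simp
    ring
  have hpos : 0 < 1 - p + p * Real.exp (b - a) := (Real.exp_pos _).trans_le hconv
  have hlog : p * (b - a) ≤ Real.log (1 - p + p * Real.exp (b - a)) :=
    (Real.le_log_iff_exp_le hpos).2 hconv
  rw [hfac, Real.log_mul (by positivity) hpos.ne']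
  linarith

/-- The left side is at most `0` and at most `a`, hence at most their average with weights `1 - m`
and `m`. This is weak duality for one eigenvalue. -/
lemma neg_log_exp_neg_add_one_le_mul (a m : ℝ) (h0 : 0 ≤ m) (h1 : m ≤ 1) :
    -Real.log (Real.exp (-a) + 1) ≤ a * m := by
  have he := Real.exp_pos (-a)
  have hl : 0 ≤ Real.log (Real.exp (-a) + 1) := Real.log_nonneg (by linarith)
  have hl' : -a ≤ Real.log (Real.exp (-a) + 1) :=
    (Real.le_log_iff_exp_le (by positivity)).2 (by linarith)
  nlinarith [mul_nonneg (sub_nonneg.2 h1) hl]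

lemma binEntropy_fermi (x : ℝ) :
    Real.binEntropy (Real.exp x + 1)⁻¹ =
      x * (Real.exp x + 1)⁻¹ + Real.log (Real.exp (-x) + 1) := by
  have hx := Real.exp_pos x
  have h1 : (1 - (Real.exp x + 1)⁻¹)⁻¹ = Real.exp (-x) + 1 := by
    rw [Real.exp_neg]
    have : (1 - (Real.exp x + 1)⁻¹) = Real.exp x / (Real.exp x + 1) := by
      field_simp
      ring
    rw [this]
    field_simp
    ring
  have h2 : Real.log (Real.exp x + 1) = x + Real.log (Real.exp (-x) + 1) := by
    have : Real.exp x + 1 = Real.exp x * (Real.exp (-x) + 1) := by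
      rw [Real.exp_neg]
      field_simp
      ring
    rw [this, Real.log_mul hx.ne' (by positivity), Real.log_exp]
  rw [Real.binEntropy, h1, inv_inv, h2]
  ring

lemma binEntropy_fermi_neg (x : ℝ) :
    Real.binEntropy (Real.exp (-x) + 1)⁻¹ = Real.binEntropy (Real.exp x + 1)⁻¹ := by
  rw [← Real.binEntropy_one_sub]
  congr 1
  rw [Real.exp_neg]
  have := Real.exp_pos x
  field_simp
  ring

/-- The entropy is even in `y`, and for `y ≥ 0` the Fermi value lies in `[0, 1/2]`, where
`binEntropy` increases. -/
lemma binEntropy_fermi_anti {x y : ℝ} (hx : 0 ≤ x) (hxy : x ≤ |y|) :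
    Real.binEntropy (Real.exp y + 1)⁻¹ ≤ Real.binEntropy (Real.exp x + 1)⁻¹ := by
  have habs : Real.binEntropy (Real.exp y + 1)⁻¹ = Real.binEntropy (Real.exp |y| + 1)⁻¹ := by
    rcases abs_choice y with h | h <;> rw [h]
    rw [binEntropy_fermi_neg]
  have hmem : ∀ z : ℝ, 0 ≤ z → (Real.exp z + 1)⁻¹ ∈ Set.Icc (0 : ℝ) 2⁻¹ := fun z hz => by
    have := Real.one_le_exp hz
    exact ⟨by positivity, inv_anti₀ (by norm_num) (by linarith)⟩
  rw [habs]
  refine Real.binEntropy_strictMonoOn.monotoneOn (hmem _ (abs_nonneg y)) (hmem _ hx) ?_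
  gcongr

lemma binEntropy_fermi_le {x : ℝ} (hx : 0 ≤ x) :
    Real.binEntropy (Real.exp x + 1)⁻¹ ≤ Real.exp (-x) * (1 + x) := by
  rw [binEntropy_fermi]
  have h1 : Real.log (Real.exp (-x) + 1) ≤ Real.exp (-x) := by
    have := Real.log_le_sub_one_of_pos (x := Real.exp (-x) + 1) (by positivity)
    linarith
  have h2 : (Real.exp x + 1)⁻¹ ≤ Real.exp (-x) := by
    rw [Real.exp_neg]
    exact inv_anti₀ (Real.exp_pos x) (by linarith)
  nlinarith

lemma entropy_correction_le {d d₀ : ℕ} (hd₀ : d₀ ≤ d) {T Δ T₀ ε : ℝ} (hT : 0 < T) (hΔ : 0 < Δ)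
    (hε : 0 < ε) (hT₀ : 0 < T₀) (h : (T : EReal) ≤ tempThreshold d d₀ Δ T₀ ε) :
    T * (d₀ * Real.log 2 + ((d : ℝ) - d₀) * Real.binEntropy (1 / (Real.exp (Δ / T) + 1))) ≤ ε := by
  simp only [tempThreshold, le_min_iff] at h
  obtain ⟨⟨h1, h2⟩, h3, -⟩ := h
  have hTT₀ : T ≤ T₀ := EReal.coe_le_coe_iff.1 h1
  have hn : (0 : ℝ) ≤ (d : ℝ) - d₀ := sub_nonneg.2 (by exact_mod_cast hd₀)
  have hl2 : 0 < Real.log 2 := Real.log_pos (by norm_num)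
  have hA : T * (d₀ * Real.log 2) ≤ ε / 2 := by
    rcases Nat.eq_zero_or_pos d₀ with h0 | h0
    · subst h0
      simp
      positivity
    · have hb : (0 : ℝ) < d₀ * 2 * Real.log 2 := by positivity
      rw [quotBound, if_pos hb, EReal.coe_le_coe_iff, le_div_iff₀ hb] at h2
      linarith
  -- The entropy estimate `exp (-x) * (1 + x)` at `x = Δ / T`, times `T`, yields the factor `T + Δ`,
  -- at most `2 * T₀ + Δ`. Each half of the correction receives `ε / 2`.
  have hB : ((d : ℝ) - d₀) * (2 * T₀ + Δ) * Real.exp (-(Δ / T)) ≤ ε / 2 := by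
    rcases hn.eq_or_lt with h0 | h0
    · rw [← h0]
      simp
      positivity
    set y := 2 * ((d : ℝ) - d₀) * (2 * T₀ + Δ) / ε with hy
    have hypos : 0 < y := by positivity
    have hyε : ((d : ℝ) - d₀) * (2 * T₀ + Δ) = y * (ε / 2) := by
      rw [hy]
      field_simp
    have hle : Real.log y ≤ Δ / T := by
      by_cases hlog : 0 < Real.log y
      · rw [quotBound, if_pos hlog, EReal.coe_le_coe_iff, le_div_iff₀ hlog] at h3
        rw [le_div_iff₀ hT]
        linarith
      · exact (not_lt.1 hlog).trans (by positivity)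
    have : y * Real.exp (-(Δ / T)) ≤ 1 := by
      rw [Real.exp_neg, ← div_eq_mul_inv, div_le_one (Real.exp_pos _)]
      exact (Real.log_le_iff_le_exp hypos).1 hle
    rw [hyε]
    nlinarith
  have hs := binEntropy_fermi_le (x := Δ / T) (by positivity)
  rw [one_div]
  calc _ = T * (d₀ * Real.log 2) +
        (((d : ℝ) - d₀) * T) * Real.binEntropy (Real.exp (Δ / T) + 1)⁻¹ := by ring
    _ ≤ ε / 2 + (((d : ℝ) - d₀) * T) * (Real.exp (-(Δ / T)) * (1 + Δ / T)) := by gcongr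
    _ = ε / 2 + ((d : ℝ) - d₀) * (T + Δ) * Real.exp (-(Δ / T)) := by
        field_simp
    _ ≤ ε / 2 + ((d : ℝ) - d₀) * (2 * T₀ + Δ) * Real.exp (-(Δ / T)) := by
        gcongr
        linarith
    _ ≤ ε := by linarith

end Scalar

/-! ### Traces in eigenbases and Klein's inequality. -/

section Spectral

variable {n : Type*} [Fintype n] [DecidableEq n] {A B : Matrix n n ℂ}

/-- The diagonal of `B` in the eigenbasis of the Hermitian matrix `A`. -/
noncomputable def eigDiag (hA : A.IsHermitian) (B : Matrix n n ℂ) (i : n) : ℝ :=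
  ((star (hA.eigenvectorUnitary : Matrix n n ℂ) * B * hA.eigenvectorUnitary) i i).re

lemma cfc_eq_conj (hA : A.IsHermitian) (f : ℝ → ℝ) :
    cfc f A = (hA.eigenvectorUnitary : Matrix n n ℂ) *
      diagonal (fun i => ((f (hA.eigenvalues i) : ℝ) : ℂ)) *
        star (hA.eigenvectorUnitary : Matrix n n ℂ) := by
  rw [hA.cfc_eq, IsHermitian.cfc, Unitary.conjStarAlgAut_apply]
  rfl

lemma re_trace_cfc_mul (hA : A.IsHermitian) (f : ℝ → ℝ) (B : Matrix n n ℂ) :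
    (cfc f A * B).trace.re = ∑ i, f (hA.eigenvalues i) * eigDiag hA B i := by
  rw [cfc_eq_conj hA, Matrix.mul_assoc, Matrix.mul_assoc, Matrix.trace_mul_comm, Matrix.mul_assoc,
    Matrix.trace, Complex.re_sum]
  refine Finset.sum_congr rfl fun i _ => ?_
  rw [diag_apply, diagonal_mul, Complex.re_ofReal_mul, eigDiag]

lemma eigDiag_one (hA : A.IsHermitian) (i : n) : eigDiag hA 1 i = 1 := by
  simp [eigDiag]

lemma re_trace_cfc (hA : A.IsHermitian) (f : ℝ → ℝ) :
    (cfc f A).trace.re = ∑ i, f (hA.eigenvalues i) := by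
  have := re_trace_cfc_mul hA f 1
  simpa [eigDiag_one] using this

lemma re_trace_mul (hA : A.IsHermitian) (B : Matrix n n ℂ) :
    (A * B).trace.re = ∑ i, hA.eigenvalues i * eigDiag hA B i := by
  have := re_trace_cfc_mul hA id B
  rwa [cfc_id ℝ A hA.isSelfAdjoint] at this

lemma eigDiag_nonneg (hA : A.IsHermitian) (hB : B.PosSemidef) (i : n) : 0 ≤ eigDiag hA B i := by
  have := (hB.conjTranspose_mul_mul_same (hA.eigenvectorUnitary : Matrix n n ℂ)).diag_nonneg
    (i := i)
  exact (Complex.le_def.1 this).1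

lemma eigDiag_le_one (hA : A.IsHermitian) (hB : (1 - B).PosSemidef) (i : n) :
    eigDiag hA B i ≤ 1 := by
  have h := eigDiag_nonneg hA hB i
  have h1 := eigDiag_one hA i
  simp only [eigDiag, Matrix.mul_sub, Matrix.sub_mul, Matrix.sub_apply, Complex.sub_re] at h h1 ⊢
  linarith

/-- The squared overlaps of the eigenbases of two Hermitian matrices. -/
noncomputable def overlap (hA : A.IsHermitian) (hB : B.IsHermitian) (i j : n) : ℝ :=
  Complex.normSq ((star (hB.eigenvectorUnitary : Matrix n n ℂ) * hA.eigenvectorUnitary) j i)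

lemma eigDiag_cfc (hA : A.IsHermitian) (hB : B.IsHermitian) (f : ℝ → ℝ) (j : n) :
    eigDiag hB (cfc f A) j = ∑ i, overlap hA hB i j * f (hA.eigenvalues i) := by
  set W := star (hB.eigenvectorUnitary : Matrix n n ℂ) * hA.eigenvectorUnitary with hW
  have : star (hB.eigenvectorUnitary : Matrix n n ℂ) * cfc f A * hB.eigenvectorUnitary =
      W * diagonal (fun i => ((f (hA.eigenvalues i) : ℝ) : ℂ)) * star W := by
    rw [cfc_eq_conj hA, hW, star_mul, star_star]
    simp only [Matrix.mul_assoc]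
  rw [eigDiag, this, Matrix.mul_apply, Complex.re_sum]
  refine Finset.sum_congr rfl fun i _ => ?_
  rw [mul_diagonal, star_apply, overlap, ← hW, mul_right_comm, Complex.star_def, Complex.mul_conj,
    ← Complex.ofReal_mul, Complex.ofReal_re]

lemma eigDiag_self (hA : A.IsHermitian) (j : n) : eigDiag hA A j = hA.eigenvalues j := by
  have := eigDiag_cfc hA hA id j
  rw [cfc_id ℝ A hA.isSelfAdjoint] at this
  rw [this]
  simp [overlap, Matrix.one_apply]

/-- With `sum_overlap_right`, this makes the overlaps doubly stochastic, which is what Klein's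
inequality needs. -/
lemma sum_overlap_left (hA : A.IsHermitian) (hB : B.IsHermitian) (j : n) :
    ∑ i, overlap hA hB i j = 1 := by
  have := eigDiag_cfc hA hB (fun _ => 1) j
  rw [cfc_const_one ℝ A hA.isSelfAdjoint, eigDiag_one] at this
  simpa using this.symm

lemma sum_overlap_right (hA : A.IsHermitian) (hB : B.IsHermitian) (i : n) :
    ∑ j, overlap hA hB i j = 1 := by
  rw [← sum_overlap_left hB hA i]
  refine Finset.sum_congr rfl fun j _ => ?_
  rw [overlap, overlap, ← Complex.normSq_conj]
  congr 1
  rw [← Complex.star_def, ← star_apply, star_mul, star_star]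

/-- **Klein's inequality** for a function with the tangent inequality on the reals. -/
lemma klein_inequality (hA : A.IsHermitian) (hB : B.IsHermitian) (φ ψ : ℝ → ℝ)
    (h : ∀ a b, φ a ≤ φ b + (a - b) * ψ b) :
    ∑ i, φ (hA.eigenvalues i) ≤
      ∑ j, φ (hB.eigenvalues j) + ((A - B) * cfc ψ B).trace.re := by
  have htr : ((A - B) * cfc ψ B).trace.re =
      ∑ j, ψ (hB.eigenvalues j) * ∑ i, overlap hA hB i j *
        (hA.eigenvalues i - hB.eigenvalues j) := by
    rw [Matrix.trace_mul_comm, Matrix.mul_sub, Matrix.trace_sub, Complex.sub_re,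
      re_trace_cfc_mul hB, re_trace_cfc_mul hB, ← Finset.sum_sub_distrib]
    refine Finset.sum_congr rfl fun j _ => ?_
    have h1 := eigDiag_cfc hA hB id j
    rw [cfc_id ℝ A hA.isSelfAdjoint] at h1
    simp only [mul_sub, Finset.sum_sub_distrib, ← Finset.sum_mul, sum_overlap_left, h1, eigDiag_self,
      id_eq, one_mul]
  rw [htr, ← Finset.sum_add_distrib]
  -- The scalar tangent inequality is averaged over pairs of eigenvalues with the overlaps as
  -- weights.
  calc ∑ i, φ (hA.eigenvalues i)
      = ∑ j, ∑ i, overlap hA hB i j * φ (hA.eigenvalues i) := by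
        rw [Finset.sum_comm]
        refine Finset.sum_congr rfl fun i _ => ?_
        rw [← Finset.sum_mul, sum_overlap_right, one_mul]
    _ ≤ _ := by
        refine Finset.sum_le_sum fun j _ => ?_
        calc ∑ i, overlap hA hB i j * φ (hA.eigenvalues i)
            ≤ ∑ i, overlap hA hB i j * (φ (hB.eigenvalues j) +
              (hA.eigenvalues i - hB.eigenvalues j) * ψ (hB.eigenvalues j)) :=
              Finset.sum_le_sum fun i _ =>
                mul_le_mul_of_nonneg_left (h _ _) (Complex.normSq_nonneg _)
          _ = _ := by
              simp only [mul_add, Finset.sum_add_distrib, ← Finset.sum_mul, ← mul_assoc,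
                sum_overlap_left, one_mul]
              rw [mul_comm (ψ _)]

lemma exp_smul_eq_cfc (hA : A.IsHermitian) (s : ℝ) :
    NormedSpace.exp (s • A) = cfc (fun x => Real.exp (s * x)) A := by
  have hinv : (hA.eigenvectorUnitary : Matrix n n ℂ)⁻¹ =
      star (hA.eigenvectorUnitary : Matrix n n ℂ) :=
    Matrix.inv_eq_left_inv (Unitary.coe_star_mul_self _)
  have hU : IsUnit (hA.eigenvectorUnitary : Matrix n n ℂ) :=
    IsUnit.of_mul_eq_one _ (Unitary.coe_mul_star_self hA.eigenvectorUnitary)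
  have hs : s • A = cfc (fun x => s * x) A := by
    rw [cfc_const_mul_id s A hA.isSelfAdjoint]
  rw [hs, cfc_eq_conj hA, cfc_eq_conj hA, ← hinv, Matrix.exp_conj _ _ hU, Matrix.exp_diagonal]
  congr 3
  ext i
  rw [Pi.coe_exp, ← Complex.exp_eq_exp_ℂ, ← Complex.ofReal_exp]

lemma exp_smul_add_one_eq_cfc (hA : A.IsHermitian) (s : ℝ) :
    NormedSpace.exp (s • A) + 1 = cfc (fun x => Real.exp (s * x) + 1) A := by
  rw [exp_smul_eq_cfc hA, cfc_add_const 1 _ A (by fun_prop) hA.isSelfAdjoint, map_one]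

lemma re_trace_log_exp (hA : A.IsHermitian) (s : ℝ) :
    (cfc Real.log (NormedSpace.exp (s • A) + 1)).trace.re =
      ∑ i, Real.log (Real.exp (s * hA.eigenvalues i) + 1) := by
  rw [exp_smul_add_one_eq_cfc hA, ← cfc_comp' Real.log _ A ?_ (by fun_prop) hA.isSelfAdjoint,
    re_trace_cfc hA]
  rintro _ ⟨x, -, rfl⟩
  exact (Real.continuousAt_log (by positivity)).continuousWithinAt

end Spectral

/-! ### The Fermi-Dirac operator: functional calculus and continuity. -/

section FermiDirac

variable {d : ℕ} {A : Matrix (Fin d) (Fin d) ℂ}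

lemma exp_smul_add_one_mul_cfc (hA : A.IsHermitian) (s : ℝ) :
    (NormedSpace.exp (s • A) + 1) * cfc (fun x => (Real.exp (s * x) + 1)⁻¹) A = 1 := by
  have hc : ContinuousOn (fun x : ℝ => (Real.exp (s * x) + 1)⁻¹) (spectrum ℝ A) :=
    ContinuousOn.inv₀ (by fun_prop) fun x _ => by positivity
  rw [exp_smul_add_one_eq_cfc hA, ← cfc_mul _ _ A (by fun_prop) hc]
  rw [show (fun x : ℝ => (Real.exp (s * x) + 1) * (Real.exp (s * x) + 1)⁻¹) = fun _ => 1 from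
    funext fun x => mul_inv_cancel₀ (by positivity)]
  exact cfc_const_one ℝ A hA.isSelfAdjoint

lemma fdMeas_eq_cfc (hA : A.IsHermitian) (T : ℝ) :
    fdMeas T A = cfc (fun x => (Real.exp (1 / T * x) + 1)⁻¹) A :=
  Matrix.inv_eq_right_inv (exp_smul_add_one_mul_cfc hA _)

lemma posSemidef_cfc (hA : A.IsHermitian) {f : ℝ → ℝ} (hf : ∀ x, 0 ≤ f x) :
    (cfc f A).PosSemidef := by
  rw [cfc_eq_conj hA]
  have hD : (diagonal fun i => ((f (hA.eigenvalues i) : ℝ) : ℂ)).PosSemidef :=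
    PosSemidef.diagonal fun i => Complex.zero_le_real.2 (hf _)
  exact hD.mul_mul_conjTranspose_same (hA.eigenvectorUnitary : Matrix (Fin d) (Fin d) ℂ)

lemma fdMeas_mem_measOps (hA : A.IsHermitian) (T : ℝ) : fdMeas T A ∈ measOps d := by
  have hc : ContinuousOn (fun x : ℝ => (Real.exp (1 / T * x) + 1)⁻¹) (spectrum ℝ A) :=
    ContinuousOn.inv₀ (by fun_prop) fun x _ => by positivity
  rw [fdMeas_eq_cfc hA]
  refine ⟨posSemidef_cfc hA fun x => by positivity, ?_⟩
  rw [show (1 : Matrix (Fin d) (Fin d) ℂ) - cfc (fun x => (Real.exp (1 / T * x) + 1)⁻¹) A =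
    cfc (fun x => 1 - (Real.exp (1 / T * x) + 1)⁻¹) A by
      rw [cfc_sub (fun _ => 1) _ A (by fun_prop) hc, cfc_const_one ℝ A hA.isSelfAdjoint]]
  exact posSemidef_cfc hA fun x => sub_nonneg.2
    (inv_le_one_of_one_le₀ (by linarith [Real.exp_pos (1 / T * x)]))

-- Inversion is continuous at units, and `exp + 1` is a unit at a Hermitian `A`. At other matrices
-- it may be singular, hence continuity only at such a point.
open scoped Matrix.Norms.Operator in
lemma continuousAt_fdMeas (hA : A.IsHermitian) (T : ℝ) :
    ContinuousAt (fdMeas T) A := by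
  have hu : IsUnit (NormedSpace.exp ((1 / T) • A) + 1) :=
    IsUnit.of_mul_eq_one _ (exp_smul_add_one_mul_cfc hA _)
  have h1 : Continuous fun A : Matrix (Fin d) (Fin d) ℂ => NormedSpace.exp ((1 / T) • A) + 1 :=
    (NormedSpace.exp_continuous.comp (continuous_const_smul _)).add continuous_const
  have h2 := NormedRing.inverse_continuousAt hu.unit
  have : fdMeas T = Ring.inverse ∘
      fun A : Matrix (Fin d) (Fin d) ℂ => NormedSpace.exp ((1 / T) • A) + 1 := by
    ext1 A
    rw [fdMeas, Matrix.nonsing_inv_eq_ringInverse]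
    rfl
  rw [this]
  exact ContinuousAt.comp h2 h1.continuousAt

end FermiDirac

/-! ### Weak duality, entropy bound and stationarity. -/

section Dual

open Filter Topology

variable {c d : ℕ} {H : Matrix (Fin d) (Fin d) ℂ} {Q : Fin c → Matrix (Fin d) (Fin d) ℂ}
  {q : Fin c → ℝ} {T : ℝ}

lemma isHermitian_shifted (hH : H.IsHermitian) (hQ : ∀ i, (Q i).IsHermitian) (μ : Fin c → ℝ) :
    (shifted H Q μ).IsHermitian := by
  refine hH.sub ?_
  rw [IsHermitian, conjTranspose_sum]
  refine Finset.sum_congr rfl fun i _ => ?_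
  rw [conjTranspose_smul, star_trivial, (hQ i).eq]

/-- Under the constraints the multiplier terms cancel, so the Lagrangian is the energy for every
`μ`. -/
lemma dotProduct_add_re_trace_shifted {M : Matrix (Fin d) (Fin d) ℂ}
    (hM : ∀ i, (Q i * M).trace = (q i : ℂ)) (μ : Fin c → ℝ) :
    μ ⬝ᵥ q + (shifted H Q μ * M).trace.re = (H * M).trace.re := by
  have : ((∑ i, μ i • Q i) * M).trace.re = μ ⬝ᵥ q := by
    rw [Matrix.sum_mul, Matrix.trace_sum, Complex.re_sum, dotProduct]
    refine Finset.sum_congr rfl fun i _ => ?_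
    rw [Matrix.smul_mul, Matrix.trace_smul, hM, Complex.real_smul, Complex.re_ofReal_mul,
      Complex.ofReal_re]
  rw [shifted, Matrix.sub_mul, Matrix.trace_sub, Complex.sub_re, this]
  ring

lemma dualFreeObj_eq {μ : Fin c → ℝ} (hA : (shifted H Q μ).IsHermitian) :
    dualFreeObj H Q q T μ = μ ⬝ᵥ q +
      ∑ i, -(T * Real.log (Real.exp (-(hA.eigenvalues i / T)) + 1)) := by
  rw [dualFreeObj, re_trace_log_exp hA, Finset.sum_neg_distrib, ← Finset.mul_sum, sub_eq_add_neg]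
  simp only [neg_mul, one_div_mul_eq_div]

/-- Weak duality for the free-energy problem. -/
lemma dualFreeObj_le (hT : 0 < T) (hH : H.IsHermitian) (hQ : ∀ i, (Q i).IsHermitian)
    (μ : Fin c → ℝ) {M : Matrix (Fin d) (Fin d) ℂ} (hM : M ∈ feasible Q q) :
    dualFreeObj H Q q T μ ≤ (H * M).trace.re := by
  have hA := isHermitian_shifted hH hQ μ
  rw [dualFreeObj_eq hA, ← dotProduct_add_re_trace_shifted hM.2 μ, re_trace_mul hA]
  gcongr with i
  have := mul_le_mul_of_nonneg_left (neg_log_exp_neg_add_one_le_mul (hA.eigenvalues i / T)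
    (eigDiag hA M i) (eigDiag_nonneg hA hM.1.1 i) (eigDiag_le_one hA hM.1.2 i)) hT.le
  calc _ = _ := (mul_neg _ _).symm
    _ ≤ _ := this
    _ = _ := by field_simp

lemma approxObj_eq (hT : 0 < T) {μ : Fin c → ℝ} (hA : (shifted H Q μ).IsHermitian) :
    approxObj H Q q T μ = dualFreeObj H Q q T μ +
      T * ∑ i, Real.binEntropy (Real.exp (hA.eigenvalues i / T) + 1)⁻¹ := by
  rw [dualFreeObj_eq hA, approxObj, fdMeas_eq_cfc hA, Matrix.trace_mul_comm,
    re_trace_cfc_mul hA, add_assoc, Finset.mul_sum, ← Finset.sum_add_distrib]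
  congr 1
  refine Finset.sum_congr rfl fun i _ => ?_
  rw [eigDiag_self, binEntropy_fermi, one_div_mul_eq_div]
  field_simp
  ring

lemma sum_binEntropy_le {A : Matrix (Fin d) (Fin d) ℂ} (hA : A.IsHermitian) {d₀ : ℕ} {Δ : ℝ}
    (hΔ : 0 < Δ) (hT : 0 < T)
    (hker : Module.finrank ℂ (LinearMap.ker (Matrix.toLin' A)) ≤ d₀)
    (hgap : ∀ x ∈ spectrum ℝ A, x ≠ 0 → Δ ≤ |x|) :
    ∑ i, Real.binEntropy (Real.exp (hA.eigenvalues i / T) + 1)⁻¹ ≤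
      d₀ * Real.log 2 + ((d : ℝ) - d₀) * Real.binEntropy (Real.exp (Δ / T) + 1)⁻¹ := by
  set s := Real.binEntropy (Real.exp (Δ / T) + 1)⁻¹ with hs
  have hsl : s ≤ Real.log 2 := Real.binEntropy_le_log_two
  -- By rank-nullity the zero eigenvalues number exactly the dimension of the kernel. Since `s ≤ log
  -- 2`, replacing their number by `d₀` only increases the bound.
  have hcard : (Finset.univ.filter fun i => hA.eigenvalues i = 0).card ≤ d₀ := by
    have h1 := hA.rank_eq_card_non_zero_eigs
    have h2 := LinearMap.finrank_range_add_finrank_ker (Matrix.toLin' A)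
    rw [Matrix.toLin'_apply', Module.finrank_fintype_fun_eq_card, ← Matrix.rank, h1,
      Fintype.card_subtype] at h2
    rw [Matrix.toLin'_apply'] at hker
    have h3 := Finset.card_filter_add_card_filter_not (s := Finset.univ)
      (fun i => hA.eigenvalues i = 0)
    rw [Finset.card_univ] at h3
    lia
  have hterm : ∀ i, Real.binEntropy (Real.exp (hA.eigenvalues i / T) + 1)⁻¹ ≤
      s + if hA.eigenvalues i = 0 then Real.log 2 - s else 0 := fun i => by
    split_ifs with h
    · linarith [Real.binEntropy_le_log_two (p := (Real.exp (hA.eigenvalues i / T) + 1)⁻¹)]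
    · rw [add_zero]
      refine binEntropy_fermi_anti (by positivity) ?_
      rw [abs_div, abs_of_pos hT]
      gcongr
      exact hgap _ (hA.eigenvalues_mem_spectrum_real i) h
  refine (Finset.sum_le_sum fun i _ => hterm i).trans ?_
  rw [Finset.sum_add_distrib, ← Finset.sum_filter, Finset.sum_const, Finset.sum_const,
    nsmul_eq_mul, nsmul_eq_mul, Finset.card_univ, Fintype.card_fin]
  have : ((Finset.univ.filter fun i => hA.eigenvalues i = 0).card : ℝ) ≤ d₀ := by
    exact_mod_cast hcard
  nlinarith

/-- The dual free energy is concave, with supergradient `q - Tr[Q M_T(μ)]`. -/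
lemma dualFreeObj_add_le (hT : 0 < T) (hH : H.IsHermitian) (hQ : ∀ i, (Q i).IsHermitian)
    (μ : Fin c → ℝ) (i : Fin c) (t : ℝ) :
    dualFreeObj H Q q T μ + t * q i ≤ dualFreeObj H Q q T (μ + Pi.single i t) +
      t * (Q i * fdMeas T (shifted H Q (μ + Pi.single i t))).trace.re := by
  set ν := μ + Pi.single i t with hν
  have hA := isHermitian_shifted hH hQ μ
  have hB := isHermitian_shifted hH hQ ν
  have hsub : shifted H Q μ - shifted H Q ν = t • Q i := by
    simp only [shifted, hν, Pi.add_apply, add_smul, Finset.sum_add_distrib]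
    rw [Finset.sum_eq_single i (f := fun j => (Pi.single i t : Fin c → ℝ) j • Q j)]
    · simp
    · intro j _ hj
      simp [Pi.single_eq_of_ne hj]
    · simp
  have hdot : ν ⬝ᵥ q = μ ⬝ᵥ q + t * q i := by
    rw [hν, add_dotProduct, single_dotProduct]
  -- The tangent is taken at the moved point `ν`, so `fdMeas` is evaluated there and a limit `t → 0`
  -- is needed later.
  have hk := klein_inequality hA hB (fun x => -(T * Real.log (Real.exp (-(x / T)) + 1)))
    (fun x => (Real.exp (1 / T * x) + 1)⁻¹) fun a b => by
      have := mul_le_mul_of_nonneg_left (neg_log_exp_neg_add_one_le (a / T) (b / T)) hT.le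
      rw [one_div_mul_eq_div]
      calc _ = _ := (mul_neg _ _).symm
        _ ≤ _ := this
        _ = _ := by field_simp
  rw [hsub, ← fdMeas_eq_cfc hB, Matrix.smul_mul, Matrix.trace_smul, Complex.smul_re,
    smul_eq_mul] at hk
  rw [dualFreeObj_eq hA, dualFreeObj_eq hB, hdot]
  linarith

/-- Maximality turns the supergradient inequality into `t * q i ≤ t * g t`. Dividing by `t` of
either sign and letting `t → 0` squeezes `g 0` to `q i`. -/
lemma trace_mul_fdMeas_of_isMaxOn (hT : 0 < T) (hH : H.IsHermitian)
    (hQ : ∀ i, (Q i).IsHermitian) {μ : Fin c → ℝ}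
    (hμ : IsMaxOn (dualFreeObj H Q q T) Set.univ μ) (i : Fin c) :
    (Q i * fdMeas T (shifted H Q μ)).trace = (q i : ℂ) := by
  set g : ℝ → ℝ := fun t => (Q i * fdMeas T (shifted H Q (μ + Pi.single i t))).trace.re with hg
  have hA := isHermitian_shifted hH hQ μ
  have hle : ∀ t, t * q i ≤ t * g t := fun t => by
    have h1 := dualFreeObj_add_le (q := q) hT hH hQ μ i t
    have h2 : dualFreeObj H Q q T (μ + Pi.single i t) ≤ dualFreeObj H Q q T μ :=
      hμ (Set.mem_univ _)
    linarith
  have hcont : ContinuousAt g 0 := by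
    have hs : Continuous fun t : ℝ => shifted H Q (μ + Pi.single i t) := by
      have : Continuous fun t : ℝ => (Pi.single i t : Fin c → ℝ) := continuous_single (A := fun _ : Fin c => ℝ) i
      unfold shifted
      fun_prop
    have hf : ContinuousAt (fun t : ℝ => fdMeas T (shifted H Q (μ + Pi.single i t))) 0 :=
      ContinuousAt.comp (g := fdMeas T)
        (by simpa only [Pi.single_zero, add_zero] using continuousAt_fdMeas hA T) hs.continuousAt
    have ht : Continuous fun M : Matrix (Fin d) (Fin d) ℂ => (Q i * M).trace.re := by fun_prop
    exact ht.continuousAt.comp hf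
  have hg0 : g 0 = q i := by
    refine le_antisymm ?_ ?_
    · refine le_of_tendsto (hcont.tendsto.mono_left nhdsWithin_le_nhds : Tendsto g (𝓝[<] 0) _) ?_
      filter_upwards [self_mem_nhdsWithin] with t ht
      exact (mul_le_mul_left_of_neg ht).1 (hle t)
    · refine ge_of_tendsto (hcont.tendsto.mono_left nhdsWithin_le_nhds : Tendsto g (𝓝[>] 0) _) ?_
      filter_upwards [self_mem_nhdsWithin] with t ht
      exact le_of_mul_le_mul_left (hle t) ht
  have hM : (fdMeas T (shifted H Q μ)).IsHermitian := (fdMeas_mem_measOps hA T).1.isHermitian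
  -- The trace of a product of two Hermitian matrices is real.
  have him : (Q i * fdMeas T (shifted H Q μ)).trace.im = 0 := by
    rw [← Complex.conj_eq_iff_im, ← Complex.star_def, ← Matrix.trace_conjTranspose,
      conjTranspose_mul, hM.eq, (hQ i).eq, Matrix.trace_mul_comm]
  refine Complex.ext ?_ ?_
  · simpa [hg] using hg0
  · simpa using him

end Dual

end FermiDirac

/-! ### The error bounds and the temperature threshold. -/

theorem mainTheorem5 (c d : ℕ)
    (H : Matrix (Fin d) (Fin d) ℂ) (hH : H.IsHermitian)
    (Q : Fin c → Matrix (Fin d) (Fin d) ℂ) (hQ : ∀ i, (Q i).IsHermitian)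
    (q : Fin c → ℝ) (hfeas : (FermiDirac.feasible Q q).Nonempty)
    (T : ℝ) (hT : 0 < T)
    (μs μT : Fin c → ℝ)
    (hμs : IsMaxOn (FermiDirac.dualObj H Q q) Set.univ μs)
    (hμT : IsMaxOn (FermiDirac.dualFreeObj H Q q T) Set.univ μT)
    (𝕄 : Set (Fin c → ℝ)) (hμs_mem : μs ∈ 𝕄) (hμT_mem : μT ∈ 𝕄)
    (d₀ : ℕ) (hd₀ : d₀ ≤ d)
    (hker : ∀ μ ∈ 𝕄,
      Module.finrank ℂ (LinearMap.ker (Matrix.toLin' (FermiDirac.shifted H Q μ))) ≤ d₀)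
    (Δ : ℝ) (hΔ : 0 < Δ)
    (hgap : ∀ μ ∈ 𝕄, ∀ x ∈ spectrum ℝ (FermiDirac.shifted H Q μ), x ≠ 0 → Δ ≤ |x|) :
    (FermiDirac.approxObj H Q q T μT ≤ FermiDirac.optValue H Q q +
        T * (d₀ * Real.log 2 + ((d : ℝ) - d₀) * Real.binEntropy (1 / (Real.exp (Δ / T) + 1)))) ∧
    (FermiDirac.optValue H Q q - T * (d₀ * Real.log 2 + ((d : ℝ) - d₀) * Real.exp (-(Δ / T))) ≤
        FermiDirac.approxObj H Q q T μT) ∧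
    (∀ ε : ℝ, 0 < ε → ∀ T₀ : ℝ, 0 < T₀ →
      (T : EReal) ≤ FermiDirac.tempThreshold d d₀ Δ T₀ ε →
        |FermiDirac.approxObj H Q q T μT - FermiDirac.optValue H Q q| ≤ ε) := by
  have hA := FermiDirac.isHermitian_shifted hH hQ μT
  have hupper : FermiDirac.approxObj H Q q T μT ≤ FermiDirac.optValue H Q q +
      T * (d₀ * Real.log 2 +
        ((d : ℝ) - d₀) * Real.binEntropy (1 / (Real.exp (Δ / T) + 1))) := by
    have hweak : FermiDirac.dualFreeObj H Q q T μT ≤ FermiDirac.optValue H Q q := by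
      refine le_csInf (hfeas.image _) ?_
      rintro _ ⟨M, hM, rfl⟩
      exact FermiDirac.dualFreeObj_le hT hH hQ μT hM
    rw [FermiDirac.approxObj_eq hT hA, one_div]
    gcongr
    exact FermiDirac.sum_binEntropy_le hA hΔ hT (hker μT hμT_mem) (hgap μT hμT_mem)
  have hlower : FermiDirac.optValue H Q q ≤ FermiDirac.approxObj H Q q T μT := by
    have htr := FermiDirac.trace_mul_fdMeas_of_isMaxOn hT hH hQ hμT
    rw [FermiDirac.approxObj, FermiDirac.dotProduct_add_re_trace_shifted htr]
    refine csInf_le ⟨FermiDirac.dualFreeObj H Q q T μT, ?_⟩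
      ⟨_, ⟨FermiDirac.fdMeas_mem_measOps hA T, htr⟩, rfl⟩
    -- Weak duality supplies the lower bound that `csInf_le` requires, in place of compactness.
    rintro _ ⟨M, hM, rfl⟩
    exact FermiDirac.dualFreeObj_le hT hH hQ μT hM
  refine ⟨hupper, ?_, fun ε hε T₀ hT₀ h => ?_⟩
  · have hn : (0 : ℝ) ≤ (d : ℝ) - d₀ := sub_nonneg.2 (by exact_mod_cast hd₀)
    -- Here `E ≤ approxObj` already holds without a correction, so nonnegativity of the subtracted
    -- term suffices.
    have : 0 ≤ T * (d₀ * Real.log 2 + ((d : ℝ) - d₀) * Real.exp (-(Δ / T))) := by positivity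
    linarith
  · have := FermiDirac.entropy_correction_le hd₀ hT hΔ hε hT₀ h
    rw [abs_le]
    constructor <;> linarith
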